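/- Let $\mathbb{X}\subset\mathbb{R}^d$ be nonempty and compact, and let $f$ be an $m$-output Gaussian process on $\mathbb{X}$ (a Gaussian process on $\mathbb{X}\times\{1,\dots,m\}$) whose prior mean and covariance functions are continuously differentiable on $\mathbb{X}$ and $\mathbb{X}\times\mathbb{X}$. Let $\mathcal{D}=\{(x_k,y_k)\}_{k=1}^n$ be data with $x_k\in\mathbb{X}$ and $y_k\in\mathbb{R}^m$, observed under centered Gaussian noise with (possibly zero) covariance matrix $R$, such that the prior covariance matrix of all the observations, $K(x_{\mathcal D},x_{\mathcal D})+R$, is invertible. For $\mathbf{x}=(x_1,\dots,x_q)\in\mathbb{X}^q$ let $$\mu_{\mathcal{D}}(\mathbf{x})=\mu(\mathbf{x})+K(\mathbf{x},x_{\mathcal D})\,(K(x_{\mathcal D},x_{\mathcal D})+R)^{-1}(y-\mu(x_{\mathcal D})),$$ $$\Sigma_{\mathcal{D}}(\mathbf{x})=K(\mathbf{x},\mathbf{x})-K(\mathbf{x},x_{\mathcal D})\,(K(x_{\mathcal D},x_{\mathcal D})+R)^{-1}K(x_{\mathcal D},\mathbf{x})$$ be the mean and the covariance of the posterior law $\mathcal{N}(\mu_{\mathcal{D}}(\mathbf{x}),\Sigma_{\mathcal{D}}(\mathbf{x}))$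 of $f(\mathbf{x})\in\mathbb{R}^{q\times m}$. Let $L(\mathbf{x})$ be any square matrices with $L(\mathbf{x})L(\mathbf{x})^T=\Sigma_{\mathcal{D}}(\mathbf{x})$ for all $\mathbf{x}\in\mathbb{X}^q$ (for instance Cholesky factors). Let $g:\mathbb{R}^{q\times m}\to\mathbb{R}^q$ and $a(\cdot,\Phi):\mathbb{R}^q\to\mathbb{R}$ be Lipschitz continuous, and let $\epsilon^1,\epsilon^2,\dots$ be i.i.d. standard normal vectors in $\mathbb{R}^{q\times m}$. Define on $\mathbb{X}^q$ $$\alpha(\mathbf{x})=\mathbb{E}\bigl[a(g(f(\mathbf{x})),\Phi)\mid\mathcal{D}\bigr],\qquad \hat\alpha_N(\mathbf{x})=\frac1N\sum_{i=1}^N a\bigl(g(\mu_{\mathcal{D}}(\mathbf{x})+L(\mathbf{x})\epsilon^i),\Phi\bigr),$$ where the expectation defining $\alpha$ is with respect to the posterior law, and put $\alpha^*=\sup_{\mathbb{X}^q}\alpha$, $\hat\alpha_N^*=\sup_{\mathbb{X}^q}\hat\alpha_N$ and $\mathcal{X}^*=\operatorname{argmax}_{\mathbb{X}^q}\alpha$.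 Then $\alpha$ is well defined, $\mathcal{X}^*\neq\emptyset$, $\hat\alpha_N$ is bounded above on $\mathbb{X}^q$ (and attains its maximum if $L$ is continuous), and: (1) $\hat\alpha_N^*\to\alpha^*$ almost surely as $N\to\infty$. (2) Almost surely, $\operatorname{dist}(\hat{\mathbf{x}}_N^*,\mathcal{X}^*)\to0$ as $N\to\infty$ for every sequence of maximizers $\hat{\mathbf{x}}_N^*\in\operatorname{argmax}_{\mathbb{X}^q}\hat\alpha_N$ $(N\ge1)$. (3) For every $\delta>0$ there are $K<\infty$ and $\beta>0$ such that for all $N\ge1$, the probability that some $\hat{\mathbf{x}}_N^*\in\operatorname{argmax}_{\mathbb{X}^q}\hat\alpha_N$ has $\operatorname{dist}(\hat{\mathbf{x}}_N^*,\mathcal{X}^*)>\delta$ is at most $Ke^{-\beta N}$; in particular $\mathbb{P}\bigl(\operatorname{dist}(\hat{\mathbf{x}}_N^*,\mathcal{X}^*)>\delta\bigr)\le Ke^{-\beta N}$ for any choice of the maximizer. (No separate moment-generating-function condition is imposed for this claim. In probability statements about sets of outcomes that need not be measurable, $\mathbb{P}$ denotes the outer measure.) -/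

import Mathlib

open MeasureTheory ProbabilityTheory Filter Topology

noncomputable section

/-- Candidate sets `(x_1, …, x_q)` of `q` points of `ℝ^d`, with the Euclidean norm of `ℝ^(qd)`. -/
abbrev Cand (d q : ℕ) : Type := PiLp 2 (fun _ : Fin q => EuclideanSpace ℝ (Fin d))

/-- The feasible candidate sets `𝕏^q`. -/
def candSet {d : ℕ} (X : Set (EuclideanSpace ℝ (Fin d))) (q : ℕ) : Set (Cand d q) :=
  {x | ∀ k, x k ∈ X}

/-- The set of maximizers of `F` over `S`. -/
def maximizers {T : Type*} (F : T → ℝ) (S : Set T) : Set T :=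
  {x | x ∈ S ∧ IsMaxOn F S x}

section Model

variable {Ω₀ : Type*} [MeasurableSpace Ω₀] {d m n q : ℕ}

/-- Prior mean function of the `i`-th output of the random function `f`. -/
def priorMean (f : EuclideanSpace ℝ (Fin d) → Fin m → Ω₀ → ℝ) (P₀ : Measure Ω₀)
    (x : EuclideanSpace ℝ (Fin d)) (i : Fin m) : ℝ :=
  ∫ w, f x i w ∂P₀

/-- Prior covariance function between the outputs `i` (at `x`) and `j` (at `y`) of `f`. -/
def priorCov (f : EuclideanSpace ℝ (Fin d) → Fin m → Ω₀ → ℝ) (P₀ : Measure Ω₀)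
    (x : EuclideanSpace ℝ (Fin d)) (i : Fin m) (y : EuclideanSpace ℝ (Fin d)) (j : Fin m) : ℝ :=
  cov[f x i, f y j; P₀]

/-- `f` is an `m`-output Gaussian process on `X` (i.e. a Gaussian process on `X × {1, …, m}`) with
continuously differentiable mean and covariance functions. Values of `f` off `X` play no role. -/
structure IsC1GPPrior (X : Set (EuclideanSpace ℝ (Fin d)))
    (f : EuclideanSpace ℝ (Fin d) → Fin m → Ω₀ → ℝ) (P₀ : Measure Ω₀) : Prop where
  isGaussianProcess : IsGaussianProcess (fun p : X × Fin m => f p.1 p.2) P₀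
  contDiffOn_mean : ∀ i, ContDiffOn ℝ 1 (fun x => priorMean f P₀ x i) X
  contDiffOn_cov : ∀ i j, ContDiffOn ℝ 1
    (fun p : EuclideanSpace ℝ (Fin d) × EuclideanSpace ℝ (Fin d) => priorCov f P₀ p.1 i p.2 j)
    (X ×ˢ X)

/-- Data `{(x_k, y_k)}` of `n` observations `y_k ∈ ℝ^m` at points `x_k`, together with the
covariance matrix of the centred Gaussian observation noise (`0` for noiseless observations,
`σ² I` for i.i.d. noise, any diagonal matrix for heteroskedastic noise). -/
structure Dataset (d m n : ℕ) where
  pt : Fin n → EuclideanSpace ℝ (Fin d)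
  obs : Fin n × Fin m → ℝ
  noiseCov : Matrix (Fin n × Fin m) (Fin n × Fin m) ℝ

/-- Prior covariance matrix of the vector of all observations: `K(x_D, x_D) + noise`. -/
def obsCov (f : EuclideanSpace ℝ (Fin d) → Fin m → Ω₀ → ℝ) (P₀ : Measure Ω₀)
    (D : Dataset d m n) : Matrix (Fin n × Fin m) (Fin n × Fin m) ℝ :=
  Matrix.of (fun p r => priorCov f P₀ (D.pt p.1) p.2 (D.pt r.1) r.2) + D.noiseCov

/-- Prior cross-covariance matrix `K(𝐱, x_D)` between `f(𝐱)` and the observations. -/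
def crossCov (f : EuclideanSpace ℝ (Fin d) → Fin m → Ω₀ → ℝ) (P₀ : Measure Ω₀)
    (D : Dataset d m n) (x : Cand d q) : Matrix (Fin q × Fin m) (Fin n × Fin m) ℝ :=
  Matrix.of (fun p r => priorCov f P₀ (x p.1) p.2 (D.pt r.1) r.2)

/-- Posterior mean `μ_D(𝐱) = μ(𝐱) + K(𝐱, x_D) (K(x_D, x_D) + noise)⁻¹ (y - μ(x_D))`. -/
def postMean (f : EuclideanSpace ℝ (Fin d) → Fin m → Ω₀ → ℝ) (P₀ : Measure Ω₀)
    (D : Dataset d m n) (x : Cand d q) : EuclideanSpace ℝ (Fin q × Fin m) :=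
  WithLp.toLp 2 (fun p => priorMean f P₀ (x p.1) p.2 +
    (crossCov f P₀ D x * (obsCov f P₀ D)⁻¹).mulVec
      (fun r => D.obs r - priorMean f P₀ (D.pt r.1) r.2) p)

/-- Posterior covariance
`K_D(𝐱) = K(𝐱, 𝐱) - K(𝐱, x_D) (K(x_D, x_D) + noise)⁻¹ K(x_D, 𝐱)`. -/
def postCov (f : EuclideanSpace ℝ (Fin d) → Fin m → Ω₀ → ℝ) (P₀ : Measure Ω₀)
    (D : Dataset d m n) (x : Cand d q) : Matrix (Fin q × Fin m) (Fin q × Fin m) ℝ :=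
  Matrix.of (fun p r => priorCov f P₀ (x p.1) p.2 (x r.1) r.2) -
    crossCov f P₀ D x * (obsCov f P₀ D)⁻¹ * (crossCov f P₀ D x).transpose

/-- The posterior law of `f(𝐱) = (f(x_1), …, f(x_q)) ∈ ℝ^(q × m)` given the data. -/
def postLaw (f : EuclideanSpace ℝ (Fin d) → Fin m → Ω₀ → ℝ) (P₀ : Measure Ω₀)
    (D : Dataset d m n) (x : Cand d q) : Measure (EuclideanSpace ℝ (Fin q × Fin m)) :=
  multivariateGaussian (postMean f P₀ D x) (postCov f P₀ D x)

/-- The acquisition function `α(𝐱) = E[u(f(𝐱)) | D]`, where `u = a(g(·), Φ)`. -/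
def acq (f : EuclideanSpace ℝ (Fin d) → Fin m → Ω₀ → ℝ) (P₀ : Measure Ω₀)
    (D : Dataset d m n) (u : EuclideanSpace ℝ (Fin q × Fin m) → ℝ) (x : Cand d q) : ℝ :=
  ∫ z, u z ∂(postLaw f P₀ D x)

/-- The reparameterization `h_D(𝐱, e) = μ_D(𝐱) + L(𝐱) e` of the posterior. -/
def reparam (f : EuclideanSpace ℝ (Fin d) → Fin m → Ω₀ → ℝ) (P₀ : Measure Ω₀)
    (D : Dataset d m n) (L : Cand d q → Matrix (Fin q × Fin m) (Fin q × Fin m) ℝ)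
    (x : Cand d q) (e : EuclideanSpace ℝ (Fin q × Fin m)) : EuclideanSpace ℝ (Fin q × Fin m) :=
  postMean f P₀ D x + Matrix.toEuclideanCLM (𝕜 := ℝ) (L x) e

/-- The sample average approximation `α̂_N(𝐱) = N⁻¹ ∑_{i < N} u(h_D(𝐱, e_i))` for the base
samples `e_0, e_1, …`, where `u = a(g(·), Φ)`. -/
def saa (f : EuclideanSpace ℝ (Fin d) → Fin m → Ω₀ → ℝ) (P₀ : Measure Ω₀)
    (D : Dataset d m n) (L : Cand d q → Matrix (Fin q × Fin m) (Fin q × Fin m) ℝ)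
    (u : EuclideanSpace ℝ (Fin q × Fin m) → ℝ) (e : ℕ → EuclideanSpace ℝ (Fin q × Fin m))
    (N : ℕ) (x : Cand d q) : ℝ :=
  (N : ℝ)⁻¹ * ∑ i ∈ Finset.range N, u (reparam f P₀ D L x (e i))

end Model

end

/-! With `u = a(g(·), Φ)` Lipschitz, reparameterization makes both objectives averages of `u(c + A
e)` over a Gaussian `e`, at the parameter `θ = (c, A)` given by the posterior mean and root. No
continuity of `L` is needed: since `L Lᵀ = Σ` is continuous on a compact set, the parameters stay in
a bounded set (`exists_norm_reparam_le`), which is totally bounded in finite dimension.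

On such a set the integrand is Lipschitz in `θ` with random constant `C + C‖e‖`, which has all
exponential moments. Chernoff's bound on a finite net, and for the random constant, gives uniform
deviations of exponentially small probability (`exists_measure_uniform_deviation_le`);
Borel–Cantelli turns this into almost sure uniform convergence. The claims then follow
deterministically from stability of suprema (`abs_sSup_image_sub_le`) and of maximizers
(`exists_infDist_maximizers_le`) under uniform perturbation. -/

/-! ### Uniform large deviations for sample averages. -/

section LargeDeviations

variable {E Ω Θ : Type*} [MeasurableSpace E] [MeasurableSpace Ω] {P : Measure Ω} {ν : Measure E}
  {ε : ℕ → Ω → E}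

/-- A measurable real function all of whose exponential moments are finite. -/
def HasExpMoments (Y : E → ℝ) (ν : Measure E) : Prop :=
  Measurable Y ∧ ∀ t : ℝ, Integrable (fun e => Real.exp (t * Y e)) ν

lemma HasExpMoments.integrableExpSet_eq {Y : E → ℝ} (hY : HasExpMoments Y ν) :
    integrableExpSet Y ν = Set.univ :=
  Set.eq_univ_of_forall hY.2

lemma HasExpMoments.integrable {Y : E → ℝ} (hY : HasExpMoments Y ν) : Integrable Y ν :=
  memLp_one_iff_integrable.mp <| by
    have := memLp_of_mem_interior_integrableExpSet (X := Y) (μ := ν)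
      (by simp [hY.integrableExpSet_eq]) 1
    simpa using this

lemma HasExpMoments.neg {Y : E → ℝ} (hY : HasExpMoments Y ν) :
    HasExpMoments (fun e => -Y e) ν :=
  ⟨hY.1.neg, fun t => by simpa using hY.2 (-t)⟩

lemma HasExpMoments.add_const {Y : E → ℝ} (hY : HasExpMoments Y ν) (c : ℝ) :
    HasExpMoments (fun e => Y e + c) ν :=
  ⟨hY.1.add_const c, fun t => by
    simpa [mul_add, Real.exp_add] using (hY.2 t).mul_const (Real.exp (t * c))⟩

lemma HasExpMoments.mono {Y Z : E → ℝ} (hY : HasExpMoments Y ν) (hZ : Measurable Z)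
    (h : ∀ e, |Z e| ≤ Y e) : HasExpMoments Z ν := by
  refine ⟨hZ, fun t => (hY.2 |t|).mono (by fun_prop) (ae_of_all _ fun e => ?_)⟩
  simp only [Real.norm_eq_abs, Real.abs_exp, Real.exp_le_exp]
  calc t * Z e ≤ |t * Z e| := le_abs_self _
    _ = |t| * |Z e| := abs_mul _ _
    _ ≤ |t| * Y e := by gcongr; exact h e

/-- **Chernoff's bound** for i.i.d. samples of a variable with negative mean. -/
lemma exists_measure_sum_nonneg_le_exp [IsProbabilityMeasure ν] [IsProbabilityMeasure P]
    (hlaw : ∀ i, HasLaw (ε i) ν P) (hindep : iIndepFun ε P) {Y : E → ℝ}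
    (hY : HasExpMoments Y ν) (hneg : ∫ e, Y e ∂ν < 0) :
    ∃ β : ℝ, 0 < β ∧ ∀ N : ℕ,
      P {ω | 0 ≤ ∑ i ∈ Finset.range N, Y (ε i ω)} ≤ ENNReal.ofReal (Real.exp (-β * N)) := by
  have hint : (0 : ℝ) ∈ interior (integrableExpSet Y ν) := by simp [hY.integrableExpSet_eq]
  have hd : HasDerivAt (mgf Y ν) (∫ e, Y e ∂ν) 0 := by
    simpa using hasDerivAt_mgf hint
  -- The mgf is 1 at 0 with slope the negative mean, so it dips below 1 just to the right; the rate
  -- is then minus its logarithm.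
  obtain ⟨t, ht0, ht⟩ : ∃ t : ℝ, 0 < t ∧ mgf Y ν t < 1 := by
    have h1 : Tendsto (slope (mgf Y ν) 0) (𝓝[>] 0) (𝓝 (∫ e, Y e ∂ν)) :=
      (hasDerivAt_iff_tendsto_slope.mp hd).mono_left
        (nhdsWithin_mono _ (fun x (hx : (0 : ℝ) < x) => hx.ne'))
    obtain ⟨t, hs, ht⟩ := ((h1.eventually_lt_const hneg).and self_mem_nhdsWithin).exists
    refine ⟨t, ht, ?_⟩
    have ht' : (0 : ℝ) < t := ht
    rw [slope_def_field, mgf_zero, sub_zero, div_lt_iff₀ ht'] at hs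
    linarith
  have hpos : 0 < mgf Y ν t := mgf_pos (hY.2 t)
  refine ⟨-Real.log (mgf Y ν t), by have := Real.log_neg hpos ht; linarith, fun N => ?_⟩
  have hYm (i : ℕ) : AEMeasurable (fun ω => Y (ε i ω)) P :=
    hY.1.comp_aemeasurable (hlaw i).aemeasurable
  have hind : iIndepFun (fun i ω => Y (ε i ω)) P := hindep.comp (fun _ => Y) fun _ => hY.1
  have hm (i : ℕ) : mgf (fun ω => Y (ε i ω)) P t = mgf Y ν t := by
    have := mgf_map (μ := P) (X := Y) (Y := ε i) (t := t) (hlaw i).aemeasurable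
      (by rw [(hlaw i).map_eq]; exact (hY.2 t).aestronglyMeasurable)
    rw [(hlaw i).map_eq] at this
    exact this.symm
  have hsum : Integrable
      (fun ω => Real.exp (t * (∑ i ∈ Finset.range N, fun ω => Y (ε i ω)) ω)) P := by
    refine mgf_pos_iff.mp ?_
    rw [hind.mgf_sum₀ hYm]
    exact Finset.prod_pos fun i _ => by rw [hm]; exact hpos
  have hch := measure_ge_le_exp_mul_mgf (μ := P) 0 ht0.le hsum
  rw [hind.mgf_sum₀ hYm] at hch
  simp only [hm, mul_zero, Real.exp_zero, one_mul, Finset.prod_const, Finset.card_range,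
    Finset.sum_apply] at hch
  rw [← ofReal_measureReal]
  refine ENNReal.ofReal_le_ofReal (hch.trans_eq ?_)
  rw [neg_neg, mul_comm, Real.exp_nat_mul, Real.exp_log hpos]

/-- Exponential rate in a weak law of large numbers that is uniform over a totally bounded family
of functions, Lipschitz in the parameter with a Lipschitz constant that has exponential moments. -/
lemma exists_measure_uniform_deviation_le [IsProbabilityMeasure ν] [IsProbabilityMeasure P]
    (hlaw : ∀ i, HasLaw (ε i) ν P) (hindep : iIndepFun ε P) [PseudoMetricSpace Θ] {S : Set Θ}
    (hS : TotallyBounded S) {h : Θ → E → ℝ} {G : E → ℝ} (hh : ∀ θ, HasExpMoments (h θ) ν)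
    (hG : HasExpMoments G ν) (hLip : ∀ θ θ' e, |h θ e - h θ' e| ≤ dist θ θ' * G e)
    {τ : ℝ} (hτ : 0 < τ) :
    ∃ K β : ℝ, 0 < β ∧ ∀ N : ℕ, 1 ≤ N →
      P {ω | ∃ θ ∈ S, τ < |(N : ℝ)⁻¹ * ∑ i ∈ Finset.range N, h θ (ε i ω) - ∫ e, h θ e ∂ν|} ≤
        ENNReal.ofReal (K * Real.exp (-β * N)) := by
  -- `M` is positive and strictly above the mean of `G`, so sample means of `G` reach `M` only with
  -- exponentially small probability.
  set M : ℝ := |∫ e, G e ∂ν| + 1 with hM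
  have hM1 : 0 < M := by positivity
  obtain ⟨T, hTfin, hTcov⟩ := Metric.totallyBounded_iff.mp hS (τ / (3 * M)) (by positivity)
  have hup (θ : Θ) := exists_measure_sum_nonneg_le_exp hlaw hindep
    ((hh θ).add_const (-(∫ e, h θ e ∂ν) - τ / 3)) (by
      rw [integral_add (hh θ).integrable (integrable_const _)]; simp; linarith)
  have hlo (θ : Θ) := exists_measure_sum_nonneg_le_exp hlaw hindep
    ((hh θ).neg.add_const ((∫ e, h θ e ∂ν) - τ / 3)) (by
      rw [integral_add (hh θ).neg.integrable (integrable_const _), integral_neg]; simp; linarith)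
  obtain ⟨βG, hβG, hGN⟩ := exists_measure_sum_nonneg_le_exp hlaw hindep (hG.add_const (-M)) (by
      rw [integral_add hG.integrable (integrable_const _)]
      simp only [integral_const, probReal_univ, one_smul]
      linarith [le_abs_self (∫ e, G e ∂ν)])
  choose βu hβu hNu using hup
  choose βl hβl hNl using hlo
  lift T to Finset Θ using hTfin
  -- The net is finite, so the smallest of all the rates is still positive.
  obtain ⟨β, hβ, hβG', hβT⟩ : ∃ β > 0, β ≤ βG ∧ ∀ θ ∈ T, β ≤ βu θ ∧ β ≤ βl θ := by
    clear hTcov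
    classical
    induction T using Finset.induction_on with
    | empty => exact ⟨βG, hβG, le_rfl, by simp⟩
    | insert a s ha ih =>
      obtain ⟨β, h0, h1, h2⟩ := ih
      refine ⟨min β (min (βu a) (βl a)), by simp [h0, hβu, hβl], by simp [h1], fun θ hθ => ?_⟩
      rcases Finset.mem_insert.mp hθ with rfl | hθ
      · simp
      · exact ⟨(min_le_left _ _).trans (h2 θ hθ).1, (min_le_left _ _).trans (h2 θ hθ).2⟩
  -- One bad event for `G`, and an upper and a lower one for each net point.
  refine ⟨1 + 2 * T.card, β, hβ, fun N hN => ?_⟩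
  have hN0 : (0 : ℝ) < N := by exact_mod_cast hN
  set A : Θ → Set Ω := fun θ =>
    {ω | 0 ≤ ∑ i ∈ Finset.range N, (h θ (ε i ω) + (-(∫ e, h θ e ∂ν) - τ / 3))}
  set B : Θ → Set Ω := fun θ =>
    {ω | 0 ≤ ∑ i ∈ Finset.range N, (-h θ (ε i ω) + ((∫ e, h θ e ∂ν) - τ / 3))}
  set C : Set Ω := {ω | 0 ≤ ∑ i ∈ Finset.range N, (G (ε i ω) + -M)}
  -- Off the bad events, three errors of at most `τ / 3` add up: sample mean at `θ` to that at a net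
  -- point `θ'`, then to the expectation at `θ'`, then to that at `θ`.
  have hsub : {ω | ∃ θ ∈ S, τ < |(N : ℝ)⁻¹ * ∑ i ∈ Finset.range N, h θ (ε i ω) -
      ∫ e, h θ e ∂ν|} ⊆ C ∪ ⋃ θ ∈ T, (A θ ∪ B θ) := by
    rintro ω ⟨θ, hθ, hdev⟩
    by_contra hω
    simp only [Set.mem_union, Set.mem_iUnion, not_or, not_exists, A, B, C, Set.mem_ofPred_eq,
      not_le, Finset.sum_add_distrib, Finset.sum_const, Finset.card_range, nsmul_eq_mul,
      Finset.sum_neg_distrib] at hω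
    obtain ⟨hC, hAB⟩ := hω
    obtain ⟨θ', hθ', hd⟩ : ∃ θ' ∈ T, dist θ θ' < τ / (3 * M) := by
      simpa using hTcov hθ
    obtain ⟨hA, hB⟩ := hAB θ' hθ'
    have hη : dist θ θ' * M ≤ τ / 3 := by
      calc dist θ θ' * M ≤ τ / (3 * M) * M := by gcongr
        _ = τ / 3 := by field_simp
    have h1 : |(N : ℝ)⁻¹ * ∑ i ∈ Finset.range N, h θ (ε i ω) -
        (N : ℝ)⁻¹ * ∑ i ∈ Finset.range N, h θ' (ε i ω)| ≤ τ / 3 := by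
      rw [← mul_sub, ← Finset.sum_sub_distrib, abs_mul, abs_of_pos (inv_pos.mpr hN0)]
      calc (N : ℝ)⁻¹ * |∑ i ∈ Finset.range N, (h θ (ε i ω) - h θ' (ε i ω))|
          ≤ (N : ℝ)⁻¹ * ∑ i ∈ Finset.range N, dist θ θ' * G (ε i ω) := by
            gcongr
            exact (Finset.abs_sum_le_sum_abs _ _).trans (Finset.sum_le_sum fun i _ => hLip _ _ _)
        _ = (N : ℝ)⁻¹ * (dist θ θ' * ∑ i ∈ Finset.range N, G (ε i ω)) := by
            rw [← Finset.mul_sum]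
        _ ≤ (N : ℝ)⁻¹ * (dist θ θ' * (N * M)) := by gcongr; linarith
        _ = dist θ θ' * M := by field_simp
        _ ≤ τ / 3 := hη
    have h2 : |(N : ℝ)⁻¹ * ∑ i ∈ Finset.range N, h θ' (ε i ω) - ∫ e, h θ' e ∂ν| ≤ τ / 3 := by
      rw [abs_le, inv_mul_eq_div, le_sub_iff_add_le, sub_le_iff_le_add, le_div_iff₀ hN0,
        div_le_iff₀ hN0]
      constructor <;> linarith
    have h3 : |∫ e, h θ' e ∂ν - ∫ e, h θ e ∂ν| ≤ τ / 3 := by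
      rw [← integral_sub (hh θ').integrable (hh θ).integrable]
      calc |∫ e, (h θ' e - h θ e) ∂ν| ≤ ∫ e, |h θ' e - h θ e| ∂ν := abs_integral_le_integral_abs
        _ ≤ ∫ e, dist θ θ' * G e ∂ν := by
            refine integral_mono ((hh θ').integrable.sub (hh θ).integrable).abs
              (hG.integrable.const_mul _) fun e => ?_
            rw [dist_comm]; exact hLip _ _ _
        _ = dist θ θ' * ∫ e, G e ∂ν := integral_const_mul _ _
        _ ≤ dist θ θ' * M := by gcongr; linarith [le_abs_self (∫ e, G e ∂ν)]
        _ ≤ τ / 3 := hη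
    have h12 := (abs_sub_le _ _ _).trans (add_le_add h1 h2)
    have h123 := (abs_sub_le _ _ _).trans (add_le_add h12 h3)
    linarith
  have hmono {b : ℝ} (hb : β ≤ b) :
      ENNReal.ofReal (Real.exp (-b * N)) ≤ ENNReal.ofReal (Real.exp (-β * N)) := by
    gcongr
  calc P _ ≤ P (C ∪ ⋃ θ ∈ T, (A θ ∪ B θ)) := measure_mono hsub
    _ ≤ P C + ∑ θ ∈ T, (P (A θ) + P (B θ)) := by
        refine (measure_union_le _ _).trans (add_le_add le_rfl ?_)
        exact (measure_biUnion_finset_le _ _).trans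
          (Finset.sum_le_sum fun θ _ => measure_union_le _ _)
    _ ≤ ENNReal.ofReal (Real.exp (-β * N)) +
        ∑ θ ∈ T, (ENNReal.ofReal (Real.exp (-β * N)) + ENNReal.ofReal (Real.exp (-β * N))) := by
        gcongr with θ hθ
        · exact (hGN N).trans (hmono hβG')
        · exact (hNu θ N).trans (hmono (hβT θ hθ).1)
        · exact (hNl θ N).trans (hmono (hβT θ hθ).2)
    _ = ENNReal.ofReal ((1 + 2 * T.card) * Real.exp (-β * N)) := by
        rw [Finset.sum_const, nsmul_eq_mul, ENNReal.ofReal_mul (by positivity),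
          ENNReal.ofReal_add (by positivity) (by positivity),
          ENNReal.ofReal_mul (by positivity)]
        simp
        ring

/-- **Borel–Cantelli** for events of exponentially small probability. -/
lemma ae_eventually_notMem_of_measure_le_exp {s : ℕ → Set Ω} {K β : ℝ} (hβ : 0 < β)
    [IsFiniteMeasure P]
    (hs : ∀ N : ℕ, 1 ≤ N → P (s N) ≤ ENNReal.ofReal (K * Real.exp (-β * N))) :
    ∀ᵐ ω ∂P, ∀ᶠ N in atTop, ω ∉ s N := by
  have hsum : Summable fun N : ℕ => |K| * Real.exp (-β * N) := by
    refine Summable.mul_left _ ?_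
    simpa [mul_comm] using Real.summable_exp_nat_mul_iff.mpr (neg_neg_of_pos hβ)
  -- The shift avoids `N = 0`, where no bound is assumed.
  have h := ae_eventually_notMem (μ := P) (s := fun N => s (N + 1)) (by
    refine ne_top_of_le_ne_top ((summable_nat_add_iff 1).mpr hsum).tsum_ofReal_ne_top
      (ENNReal.tsum_le_tsum fun N => (hs (N + 1) (by omega)).trans ?_)
    gcongr
    exact le_abs_self K)
  filter_upwards [h] with ω hω
  rw [eventually_atTop] at hω ⊢
  obtain ⟨a, ha⟩ := hω
  refine ⟨a + 1, fun N hN => ?_⟩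
  obtain ⟨k, rfl⟩ := Nat.exists_eq_add_of_le' (show 1 ≤ N by omega)
  exact ha k (by omega)

end LargeDeviations

/-! ### Stability of suprema and maximizers. -/

section Argmax

lemma maximizers_nonempty {T : Type*} [TopologicalSpace T] {S : Set T} (hS : IsCompact S)
    (hne : S.Nonempty) {F : T → ℝ} (hF : ContinuousOn F S) : (maximizers F S).Nonempty :=
  hS.exists_isMaxOn hne hF

/-- Uniformly close functions have close suprema. -/
lemma abs_sSup_image_sub_le {T : Type*} {S : Set T} (hne : S.Nonempty) {F α : T → ℝ}
    (hα : BddAbove (α '' S)) {τ : ℝ} (h : ∀ x ∈ S, |F x - α x| ≤ τ) :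
    |sSup (F '' S) - sSup (α '' S)| ≤ τ := by
  have hF : BddAbove (F '' S) := by
    obtain ⟨b, hb⟩ := hα
    refine ⟨b + τ, ?_⟩
    rintro _ ⟨x, hx, rfl⟩
    linarith [(abs_le.mp (h x hx)).2, hb (Set.mem_image_of_mem α hx)]
  rw [abs_le, neg_le_sub_iff_le_add, sub_le_iff_le_add]
  constructor
  · refine csSup_le (hne.image _) ?_
    rintro _ ⟨x, hx, rfl⟩
    linarith [(abs_le.mp (h x hx)).1, le_csSup hF (Set.mem_image_of_mem F hx)]
  · refine csSup_le (hne.image _) ?_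
    rintro _ ⟨x, hx, rfl⟩
    linarith [(abs_le.mp (h x hx)).2, le_csSup hα (Set.mem_image_of_mem α hx)]

/-- Maximizers of functions uniformly close to a continuous function on a compact set are close
to the set of maximizers of that function. -/
lemma exists_infDist_maximizers_le {T : Type*} [PseudoMetricSpace T] {S : Set T}
    (hS : IsCompact S) (hne : S.Nonempty) {α : T → ℝ} (hα : ContinuousOn α S) {δ : ℝ}
    (hδ : 0 < δ) :
    ∃ τ : ℝ, 0 < τ ∧ ∀ F : T → ℝ, (∀ x ∈ S, |F x - α x| ≤ τ) →
      ∀ x ∈ maximizers F S, Metric.infDist x (maximizers α S) ≤ δ := by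
  obtain ⟨x₀, hx₀, hmax⟩ := maximizers_nonempty hS hne hα
  set S' : Set T := S ∩ {x | δ ≤ Metric.infDist x (maximizers α S)}
  have hS' : IsCompact S' :=
    hS.inter_right (isClosed_le continuous_const (Metric.continuous_infDist_pt _))
  rcases S'.eq_empty_or_nonempty with hemp | hne'
  · refine ⟨1, one_pos, fun F _ x hx => ?_⟩
    by_contra! hlt
    exact Set.notMem_empty x (hemp ▸ ⟨hx.1, hlt.le⟩)
  · obtain ⟨x₁, hx₁, hmax₁⟩ := hS'.exists_isMaxOn hne' (hα.mono Set.inter_subset_left)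
    have hlt : α x₁ < α x₀ := by
      refine lt_of_le_of_ne (hmax hx₁.1) fun heq => ?_
      have hmem : x₁ ∈ maximizers α S := ⟨hx₁.1, fun y hy => (hmax hy).trans_eq heq.symm⟩
      have h0 : δ ≤ Metric.infDist x₁ (maximizers α S) := hx₁.2
      linarith [Metric.infDist_zero_of_mem hmem]
    -- A maximizer of `F` at distance over `δ` would force the gap `α x₀ - α x₁` to be at most `2τ`,
    -- two thirds of itself.
    refine ⟨(α x₀ - α x₁) / 3, by linarith, fun F hF x hx => ?_⟩
    by_contra! hδx
    have h1 : α x ≤ α x₁ := hmax₁ ⟨hx.1, hδx.le⟩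
    have h2 : F x₀ ≤ F x := hx.2 hx₀
    have h3 := (abs_le.mp (hF x hx.1)).2
    have h4 := (abs_le.mp (hF x₀ hx₀)).1
    linarith

end Argmax

/-! ### Gaussian vectors. -/

section Gaussian

variable {ι : Type*} [Fintype ι] [DecidableEq ι]

open scoped Matrix.Norms.L2Operator MatrixOrder in
lemma continuousOn_matrix_sqrt :
    ContinuousOn (CFC.sqrt : Matrix ι ι ℝ → Matrix ι ι ℝ) {A | A.PosSemidef} := by
  have := CFC.continuousOn_sqrt (A := Matrix ι ι ℝ)
  simpa [Matrix.nonneg_iff_posSemidef] using this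

/-- An affine image of a standard Gaussian vector is Gaussian. -/
lemma map_stdGaussian_eq_multivariateGaussian (c : EuclideanSpace ℝ ι) (A : Matrix ι ι ℝ) :
    (stdGaussian (EuclideanSpace ℝ ι)).map (fun e => c + Matrix.toEuclideanCLM (𝕜 := ℝ) A e) =
      multivariateGaussian c (A * A.transpose) := by
  have hS : (A * A.transpose).PosSemidef := by
    simpa using Matrix.posSemidef_self_mul_conjTranspose A
  have h : (fun x ↦ c + x) ∘ (Matrix.toEuclideanCLM (𝕜 := ℝ) A) =
    (fun x ↦ c + (Matrix.toEuclideanCLM (𝕜 := ℝ) A) x) := rfl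
  have : IsGaussian ((stdGaussian (EuclideanSpace ℝ ι)).map
      (fun e => c + Matrix.toEuclideanCLM (𝕜 := ℝ) A e)) := by
    rw [← h, ← Measure.map_map (measurable_const_add c) (by fun_prop)]
    infer_instance
  apply IsGaussian.ext
  · simp only [id_eq, integral_id_multivariateGaussian]
    rw [integral_map (by fun_prop) (by fun_prop), integral_add (integrable_const _), integral_const]
    · simp [ContinuousLinearMap.integral_comp_comm _ IsGaussian.integrable_fun_id]
    · exact IsGaussian.integrable_id.comp_measurable (by fun_prop)
  · ext x y
    rw [covarianceBilin_multivariateGaussian hS]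
    rw [← h, ← Measure.map_map (measurable_const_add c) (by fun_prop), covarianceBilin_map_const_add,
      covarianceBilin_map, covarianceBilin_stdGaussian, innerSL_apply_apply,
      ContinuousLinearMap.adjoint_inner_left, ← ContinuousLinearMap.star_eq_adjoint, ← map_star,
      ← ContinuousLinearMap.comp_apply, ← ContinuousLinearMap.mul_def, ← map_mul,
      Matrix.star_eq_conjTranspose, Matrix.conjTranspose_eq_transpose_of_trivial,
      Matrix.inner_toEuclideanCLM]
    exact IsGaussian.memLp_two_id

/-- A Gaussian norm has finite exponential moments. -/
lemma integrable_exp_mul_norm_of_isGaussian {E : Type*} [NormedAddCommGroup E] [NormedSpace ℝ E]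
    [MeasurableSpace E] [BorelSpace E] [SecondCountableTopology E] [CompleteSpace E]
    (ν : Measure E) [IsGaussian ν] (t : ℝ) : Integrable (fun e => Real.exp (t * ‖e‖)) ν := by
  obtain ⟨C, hC, hint⟩ := IsGaussian.exists_integrable_exp_sq ν
  refine (hint.const_mul (Real.exp (t ^ 2 / (4 * C)))).mono (by fun_prop) (ae_of_all _ fun e => ?_)
  simp only [Real.norm_eq_abs, Real.abs_exp, ← Real.exp_add, Real.exp_le_exp]
  -- Completing the square dominates the exponential by Fernique's integrable `exp (C‖e‖²)`.
  have : t ^ 2 / (4 * C) + C * ‖e‖ ^ 2 - t * ‖e‖ = (t - 2 * C * ‖e‖) ^ 2 / (4 * C) := by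
    field_simp; ring
  have : 0 ≤ (t - 2 * C * ‖e‖) ^ 2 / (4 * C) := by positivity
  linarith

lemma hasExpMoments_affine_norm {E : Type*} [NormedAddCommGroup E] [NormedSpace ℝ E]
    [MeasurableSpace E] [BorelSpace E] [SecondCountableTopology E] [CompleteSpace E]
    (ν : Measure E) [IsGaussian ν] (a b : ℝ) : HasExpMoments (fun e => a + b * ‖e‖) ν := by
  refine ⟨by fun_prop, fun t => ?_⟩
  simpa [mul_add, Real.exp_add, mul_assoc] using
    (integrable_exp_mul_norm_of_isGaussian ν (t * b)).const_mul (Real.exp (t * a))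

end Gaussian

/-! ### Lipschitz functions of affine images of a Gaussian vector. -/

section AffineFamily

variable {E : Type*} [NormedAddCommGroup E] [NormedSpace ℝ E] {u : E → ℝ} {C : NNReal}

lemma abs_comp_affine_sub_le (hu : LipschitzWith C u) (θ θ' : E × (E →L[ℝ] E)) (e : E) :
    |u (θ.1 + θ.2 e) - u (θ'.1 + θ'.2 e)| ≤ dist θ θ' * (C + C * ‖e‖) := by
  rw [← Real.dist_eq]
  have h1 : ‖θ.1 - θ'.1‖ ≤ dist θ θ' := by rw [dist_eq_norm]; exact norm_fst_le (θ - θ')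
  have h2 : ‖θ.2 - θ'.2‖ ≤ dist θ θ' := by rw [dist_eq_norm]; exact norm_snd_le (θ - θ')
  calc dist (u (θ.1 + θ.2 e)) (u (θ'.1 + θ'.2 e))
      ≤ C * dist (θ.1 + θ.2 e) (θ'.1 + θ'.2 e) := hu.dist_le_mul _ _
    _ = C * ‖(θ.1 - θ'.1) + (θ.2 - θ'.2) e‖ := by
        rw [dist_eq_norm, sub_apply]; congr 2; abel
    _ ≤ C * (dist θ θ' + dist θ θ' * ‖e‖) := by
        gcongr
        refine (norm_add_le _ _).trans (add_le_add h1 (((θ.2 - θ'.2).le_opNorm e).trans ?_))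
        gcongr
    _ = dist θ θ' * (C + C * ‖e‖) := by ring

lemma abs_comp_affine_le (hu : LipschitzWith C u) (θ : E × (E →L[ℝ] E)) (e : E) :
    |u (θ.1 + θ.2 e)| ≤ (|u 0| + ‖θ‖ * C) + ‖θ‖ * C * ‖e‖ := by
  -- At the zero parameter the integrand is the constant `u 0`.
  have h := abs_comp_affine_sub_le hu θ 0 e
  simp only [Prod.fst_zero, Prod.snd_zero, zero_apply, add_zero,
    dist_zero_right] at h
  have := abs_sub_abs_le_abs_sub (u (θ.1 + θ.2 e)) (u 0)
  linarith

variable [MeasurableSpace E] [BorelSpace E] [SecondCountableTopology E] [CompleteSpace E]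

lemma hasExpMoments_comp_affine (hu : LipschitzWith C u) (ν : Measure E) [IsGaussian ν]
    (θ : E × (E →L[ℝ] E)) : HasExpMoments (fun e => u (θ.1 + θ.2 e)) ν :=
  (hasExpMoments_affine_norm ν _ _).mono
    (hu.continuous.comp (by fun_prop : Continuous fun e => θ.1 + θ.2 e)).measurable
    (abs_comp_affine_le hu θ)

lemma continuous_integral_comp_affine (hu : LipschitzWith C u) (ν : Measure E) [IsGaussian ν] :
    Continuous fun θ : E × (E →L[ℝ] E) => ∫ e, u (θ.1 + θ.2 e) ∂ν := by
  have hG := (hasExpMoments_affine_norm ν C C).integrable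
  refine (LipschitzWith.of_dist_le_mul (K := (∫ e, (C + C * ‖e‖) ∂ν).toNNReal)
    fun θ θ' => ?_).continuous
  rw [Real.coe_toNNReal _ (integral_nonneg fun e => by positivity), Real.dist_eq,
    ← integral_sub (hasExpMoments_comp_affine hu ν θ).integrable
      (hasExpMoments_comp_affine hu ν θ').integrable]
  calc |∫ e, (u (θ.1 + θ.2 e) - u (θ'.1 + θ'.2 e)) ∂ν|
      ≤ ∫ e, |u (θ.1 + θ.2 e) - u (θ'.1 + θ'.2 e)| ∂ν := abs_integral_le_integral_abs
    _ ≤ ∫ e, dist θ θ' * (C + C * ‖e‖) ∂ν :=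
        integral_mono ((hasExpMoments_comp_affine hu ν θ).integrable.sub
          (hasExpMoments_comp_affine hu ν θ').integrable).abs (hG.const_mul _)
          fun e => abs_comp_affine_sub_le hu θ θ' e
    _ = (∫ e, (C + C * ‖e‖) ∂ν) * dist θ θ' := by rw [integral_const_mul, mul_comm]

end AffineFamily

/-! ### Posterior moments and the acquisition function. -/

section Posterior

variable {Ω₀ : Type*} [MeasurableSpace Ω₀] {d m n q : ℕ} {X : Set (EuclideanSpace ℝ (Fin d))}
  {P₀ : Measure Ω₀} {f : EuclideanSpace ℝ (Fin d) → Fin m → Ω₀ → ℝ} {D : Dataset d m n}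

lemma isCompact_candSet (hX : IsCompact X) (q : ℕ) : IsCompact (candSet X q) := by
  have h : candSet X q = (PiLp.homeomorph 2 (fun _ : Fin q => EuclideanSpace ℝ (Fin d))) ⁻¹'
      (Set.univ.pi fun _ => X) := by
    ext x; simp [candSet, PiLp.homeomorph]
  rw [h, Homeomorph.isCompact_preimage]
  exact isCompact_univ_pi fun _ => hX

lemma candSet_nonempty (hX : X.Nonempty) (q : ℕ) : (candSet X q).Nonempty :=
  let ⟨x, hx⟩ := hX
  ⟨WithLp.toLp 2 fun _ => x, fun _ => hx⟩

lemma continuousOn_priorMean (hf : IsC1GPPrior X f P₀) (k : Fin q) (i : Fin m) :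
    ContinuousOn (fun x : Cand d q => priorMean f P₀ (x k) i) (candSet X q) :=
  (hf.contDiffOn_mean i).continuousOn.comp (by fun_prop) fun _ hx => hx k

lemma continuousOn_priorCov (hf : IsC1GPPrior X f P₀) (k l : Fin q) (i j : Fin m) :
    ContinuousOn (fun x : Cand d q => priorCov f P₀ (x k) i (x l) j) (candSet X q) :=
  (hf.contDiffOn_cov i j).continuousOn.comp (f := fun x : Cand d q => (x k, x l))
    (by fun_prop) fun _ hx => ⟨hx k, hx l⟩

lemma continuousOn_crossCov (hf : IsC1GPPrior X f P₀) (hD : ∀ k, D.pt k ∈ X) :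
    ContinuousOn (crossCov f P₀ D : Cand d q → _) (candSet X q) :=
  continuousOn_pi.mpr fun p => continuousOn_pi.mpr fun r =>
    (hf.contDiffOn_cov p.2 r.2).continuousOn.comp (f := fun x : Cand d q => (x p.1, D.pt r.1))
      (by fun_prop) fun _ hx => ⟨hx p.1, hD r.1⟩

lemma continuousOn_postMean (hf : IsC1GPPrior X f P₀) (hD : ∀ k, D.pt k ∈ X) :
    ContinuousOn (postMean f P₀ D : Cand d q → _) (candSet X q) := by
  refine (PiLp.continuous_toLp 2 _).comp_continuousOn (continuousOn_pi.mpr fun p =>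
    (continuousOn_priorMean hf p.1 p.2).add ?_)
  have h : Continuous fun A : Matrix (Fin q × Fin m) (Fin n × Fin m) ℝ =>
      (A * (obsCov f P₀ D)⁻¹).mulVec
        (fun r => D.obs r - priorMean f P₀ (D.pt r.1) r.2) p := by fun_prop
  exact h.comp_continuousOn (continuousOn_crossCov hf hD)

lemma continuousOn_postCov (hf : IsC1GPPrior X f P₀) (hD : ∀ k, D.pt k ∈ X) :
    ContinuousOn (postCov f P₀ D : Cand d q → _) (candSet X q) := by
  refine ContinuousOn.sub (continuousOn_pi.mpr fun p => continuousOn_pi.mpr fun r =>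
    continuousOn_priorCov hf p.1 r.1 p.2 r.2) ?_
  have h : Continuous fun A : Matrix (Fin q × Fin m) (Fin n × Fin m) ℝ =>
      A * (obsCov f P₀ D)⁻¹ * A.transpose := by fun_prop
  exact h.comp_continuousOn (continuousOn_crossCov hf hD)

lemma continuous_toEuclideanCLM {ι : Type*} [Fintype ι] [DecidableEq ι] :
    Continuous (Matrix.toEuclideanCLM (n := ι) (𝕜 := ℝ)) :=
  LinearMap.continuous_of_finiteDimensional
    (Matrix.toEuclideanCLM (n := ι) (𝕜 := ℝ)).toAlgEquiv.toLinearMap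

-- The given root `L` may be discontinuous, but the law depends only on the mean and covariance, so
-- the positive semidefinite square root, which is continuous in the covariance, can parameterize it
-- instead.
open scoped MatrixOrder in
lemma continuousOn_acq (hf : IsC1GPPrior X f P₀) (hD : ∀ k, D.pt k ∈ X)
    (hpsd : ∀ x ∈ candSet X q, (postCov f P₀ D x).PosSemidef)
    {u : EuclideanSpace ℝ (Fin q × Fin m) → ℝ} {C : NNReal} (hu : LipschitzWith C u) :
    ContinuousOn (acq f P₀ D u) (candSet X q) := by
  have h : ContinuousOn (fun x : Cand d q => (postMean f P₀ D x,
      Matrix.toEuclideanCLM (𝕜 := ℝ) (CFC.sqrt (postCov f P₀ D x)))) (candSet X q) :=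
    (continuousOn_postMean hf hD).prodMk (continuous_toEuclideanCLM.comp_continuousOn
      (continuousOn_matrix_sqrt.comp (continuousOn_postCov hf hD) hpsd))
  refine ((continuous_integral_comp_affine hu
    (stdGaussian (EuclideanSpace ℝ (Fin q × Fin m)))).comp_continuousOn h).congr fun x _ => ?_
  rw [acq, postLaw, multivariateGaussian, integral_map (by fun_prop)
    hu.continuous.aestronglyMeasurable]
  rfl

lemma acq_eq_integral_reparam {u : EuclideanSpace ℝ (Fin q × Fin m) → ℝ} (hu : Continuous u)
    {L : Cand d q → Matrix (Fin q × Fin m) (Fin q × Fin m) ℝ} {x : Cand d q}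
    (hL : L x * (L x).transpose = postCov f P₀ D x) :
    acq f P₀ D u x =
      ∫ e, u (reparam f P₀ D L x e) ∂(stdGaussian (EuclideanSpace ℝ (Fin q × Fin m))) := by
  rw [acq, postLaw, ← hL, ← map_stdGaussian_eq_multivariateGaussian,
    integral_map (by fun_prop) hu.aestronglyMeasurable]
  rfl

/-- Root decompositions of the posterior covariance are uniformly bounded, whatever their
regularity. -/
lemma exists_norm_reparam_le (hX : IsCompact X) (hf : IsC1GPPrior X f P₀)
    (hD : ∀ k, D.pt k ∈ X) {L : Cand d q → Matrix (Fin q × Fin m) (Fin q × Fin m) ℝ}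
    (hL : ∀ x ∈ candSet X q, L x * (L x).transpose = postCov f P₀ D x) :
    ∃ B : ℝ, ∀ x ∈ candSet X q,
      ‖(postMean f P₀ D x, Matrix.toEuclideanCLM (𝕜 := ℝ) (L x))‖ ≤ B := by
  obtain ⟨B₁, hB₁⟩ := (isCompact_candSet hX q).exists_bound_of_continuousOn
    (continuousOn_postMean hf hD)
  obtain ⟨B₂, hB₂⟩ := (isCompact_candSet hX q).exists_bound_of_continuousOn
    (continuous_toEuclideanCLM.comp_continuousOn (continuousOn_postCov hf hD))
  refine ⟨max B₁ (√B₂), fun x hx => max_le_max (hB₁ x hx) ?_⟩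
  refine Real.le_sqrt_of_sq_le ?_
  -- The C⋆-identity `‖L‖² = ‖L L⋆‖` bounds any root by the covariance alone.
  have h : ‖Matrix.toEuclideanCLM (𝕜 := ℝ) (L x) *
      star (Matrix.toEuclideanCLM (𝕜 := ℝ) (L x))‖ ≤ B₂ := by
    rw [← map_star, ← map_mul, Matrix.star_eq_conjTranspose,
      Matrix.conjTranspose_eq_transpose_of_trivial, hL x hx]
    exact hB₂ x hx
  rw [sq]
  exact (CStarRing.norm_self_mul_star (x := Matrix.toEuclideanCLM (𝕜 := ℝ) (L x))).symm.trans_le h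

end Posterior

/-! ### The main theorem. -/

theorem theorem1
    {d m n q : ℕ}
    -- compact design space
    (X : Set (EuclideanSpace ℝ (Fin d))) (hXc : IsCompact X) (hXne : X.Nonempty)
    -- Gaussian process prior with continuously differentiable mean and covariance functions
    {Ω₀ : Type*} [MeasurableSpace Ω₀] (P₀ : Measure Ω₀) [IsProbabilityMeasure P₀]
    (f : EuclideanSpace ℝ (Fin d) → Fin m → Ω₀ → ℝ) (hf : IsC1GPPrior X f P₀)
    -- the data, for which the Gaussian conditioning formulas make sense
    (D : Dataset d m n) (hDX : ∀ k, D.pt k ∈ X) (hDnoise : D.noiseCov.PosSemidef)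
    (hDinv : IsUnit (obsCov f P₀ D).det)
    -- Lipschitz objective and utility functions
    (g : EuclideanSpace ℝ (Fin q × Fin m) → EuclideanSpace ℝ (Fin q))
    (hg : ∃ C, LipschitzWith C g)
    {Par : Type*} (a : EuclideanSpace ℝ (Fin q) → Par → ℝ) (φ : Par)
    (ha : ∃ C, LipschitzWith C (fun v => a v φ))
    -- a root decomposition (e.g. Cholesky) of the posterior covariance
    (L : Cand d q → Matrix (Fin q × Fin m) (Fin q × Fin m) ℝ)
    (hL : ∀ x ∈ candSet X q, L x * (L x).transpose = postCov f P₀ D x)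
    -- i.i.d. standard normal base samples
    {Ω : Type*} [MeasurableSpace Ω] (P : Measure Ω) [IsProbabilityMeasure P]
    (ε : ℕ → Ω → EuclideanSpace ℝ (Fin q × Fin m))
    (hlaw : ∀ i, HasLaw (ε i) (stdGaussian (EuclideanSpace ℝ (Fin q × Fin m))) P)
    (hindep : iIndepFun ε P) :
    let u : EuclideanSpace ℝ (Fin q × Fin m) → ℝ := fun z => a (g z) φ
    let α : Cand d q → ℝ := acq f P₀ D u
    let αhat : ℕ → Ω → Cand d q → ℝ := fun N ω => saa f P₀ D L u (fun i => ε i ω) N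
    let Xstar : Set (Cand d q) := maximizers α (candSet X q)
    -- the quantities in the claims are well defined
    (∀ x ∈ candSet X q, Integrable u (postLaw f P₀ D x)) ∧
    Xstar.Nonempty ∧
    (∀ N ω, BddAbove (αhat N ω '' candSet X q)) ∧
    (ContinuousOn L (candSet X q) →
      ∀ N ω, (maximizers (αhat N ω) (candSet X q)).Nonempty) ∧
    -- (1) convergence of the optimal values
    (∀ᵐ ω ∂P, Tendsto (fun N => sSup (αhat N ω '' candSet X q)) atTop
      (𝓝 (sSup (α '' candSet X q)))) ∧
    -- (2) convergence of every sequence of optimizers to the set of true optimizers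
    (∀ᵐ ω ∂P, ∀ xhat : ℕ → Cand d q,
      (∀ N, 1 ≤ N → xhat N ∈ maximizers (αhat N ω) (candSet X q)) →
      Tendsto (fun N => Metric.infDist (xhat N) Xstar) atTop (𝓝 0)) ∧
    -- (3) exponential rate, uniformly over the choice of the optimizer
    (∀ δ : ℝ, 0 < δ → ∃ K β : ℝ, 0 < β ∧ ∀ N : ℕ, 1 ≤ N →
      P {ω | ∃ xhat ∈ maximizers (αhat N ω) (candSet X q), δ < Metric.infDist xhat Xstar} ≤
        ENNReal.ofReal (K * Real.exp (-β * N))) := by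
  intro u α αhat Xstar
  obtain ⟨Cg, hCg⟩ := hg
  obtain ⟨Ca, hCa⟩ := ha
  have hu : LipschitzWith (Ca * Cg) u := hCa.comp hCg
  set S := candSet X q with hS
  have hSc : IsCompact S := isCompact_candSet hXc q
  have hSne : S.Nonempty := candSet_nonempty hXne q
  have hpsd : ∀ x ∈ S, (postCov f P₀ D x).PosSemidef := fun x hx => by
    rw [← hL x hx]
    simpa using Matrix.posSemidef_self_mul_conjTranspose (L x)
  have hα : ContinuousOn α S := continuousOn_acq hf hDX hpsd hu
  have hαb : BddAbove (α '' S) := (hSc.image_of_continuousOn hα).bddAbove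
  obtain ⟨B, hB⟩ := exists_norm_reparam_le hXc hf hDX hL
  have hdev : ∀ τ : ℝ, 0 < τ → ∃ K β : ℝ, 0 < β ∧ ∀ N : ℕ, 1 ≤ N →
      P {ω | ∃ x ∈ S, τ < |αhat N ω x - α x|} ≤ ENNReal.ofReal (K * Real.exp (-β * N)) := by
    intro τ hτ
    -- The uniform law is applied on a whole ball of parameters, which contains the image of `S`
    -- however irregular `L` is.
    obtain ⟨K, β, hβ, h⟩ := exists_measure_uniform_deviation_le hlaw hindep
      (isCompact_closedBall (0 : EuclideanSpace ℝ (Fin q × Fin m) ×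
        (EuclideanSpace ℝ (Fin q × Fin m) →L[ℝ] EuclideanSpace ℝ (Fin q × Fin m)))
        B).totallyBounded
      (hasExpMoments_comp_affine hu _) (hasExpMoments_affine_norm _ _ _)
      (abs_comp_affine_sub_le hu) hτ
    refine ⟨K, β, hβ, fun N hN => (measure_mono ?_).trans (h N hN)⟩
    rintro ω ⟨x, hx, hlt⟩
    refine ⟨_, mem_closedBall_zero_iff.mpr (hB x hx), ?_⟩
    rw [show α x = _ from acq_eq_integral_reparam hu.continuous (hL x hx)] at hlt
    exact hlt
  have hae : ∀ᵐ ω ∂P, ∀ τ : ℝ, 0 < τ → ∀ᶠ N in atTop, ∀ x ∈ S, |αhat N ω x - α x| ≤ τ := by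
    -- Countably many thresholds suffice for a single null set serving all `τ`.
    have h : ∀ k : ℕ, ∀ᵐ ω ∂P, ∀ᶠ N in atTop,
        ω ∉ {ω | ∃ x ∈ S, 1 / ((k : ℝ) + 1) < |αhat N ω x - α x|} := fun k => by
      obtain ⟨K, β, hβ, hK⟩ := hdev (1 / ((k : ℝ) + 1)) (by positivity)
      exact ae_eventually_notMem_of_measure_le_exp hβ hK
    filter_upwards [ae_all_iff.mpr h] with ω hω τ hτ
    obtain ⟨k, hk⟩ := exists_nat_one_div_lt hτ
    filter_upwards [hω k] with N hN x hx
    by_contra! hlt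
    exact hN ⟨x, hx, hk.trans hlt⟩
  refine ⟨fun x hx => ?_, maximizers_nonempty hSc hSne hα, fun N ω => ?_, fun hLc N ω => ?_,
    ?_, ?_, fun δ hδ => ?_⟩
  · rw [postLaw, multivariateGaussian, integrable_map_measure
      hu.continuous.aestronglyMeasurable (by fun_prop)]
    exact (hasExpMoments_comp_affine hu _ (_, _)).integrable
  · refine ⟨(N : ℝ)⁻¹ * ∑ i ∈ Finset.range N,
      ((|u 0| + B * (Ca * Cg : NNReal)) + B * (Ca * Cg : NNReal) * ‖ε i ω‖), ?_⟩
    rintro _ ⟨x, hx, rfl⟩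
    refine mul_le_mul_of_nonneg_left (Finset.sum_le_sum fun i _ => ?_) (by positivity)
    refine (le_abs_self _).trans ((abs_comp_affine_le hu
      (postMean f P₀ D x, Matrix.toEuclideanCLM (𝕜 := ℝ) (L x)) (ε i ω)).trans ?_)
    gcongr <;> exact hB x hx
  · refine maximizers_nonempty hSc hSne (continuousOn_const.mul
      (continuousOn_finsetSum _ fun i _ => hu.continuous.comp_continuousOn
        ((continuousOn_postMean hf hDX).add ?_)))
    exact (continuous_toEuclideanCLM.comp_continuousOn hLc).clm_apply continuousOn_const
  · filter_upwards [hae] with ω hω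
    refine Metric.tendsto_nhds.mpr fun τ hτ => ?_
    filter_upwards [hω (τ / 2) (by positivity)] with N hN
    exact (abs_sSup_image_sub_le hSne hαb hN).trans_lt (by linarith)
  · filter_upwards [hae] with ω hω xhat hxhat
    refine Metric.tendsto_nhds.mpr fun δ hδ => ?_
    -- Halving `δ` turns the non-strict bound into the strict one required.
    obtain ⟨τ, hτ, h⟩ := exists_infDist_maximizers_le hSc hSne hα (half_pos hδ)
    filter_upwards [hω τ hτ, eventually_ge_atTop 1] with N hN hN1
    rw [Real.dist_0_eq_abs, abs_of_nonneg Metric.infDist_nonneg]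
    exact (h _ hN _ (hxhat N hN1)).trans_lt (by linarith)
  · obtain ⟨τ, hτ, h⟩ := exists_infDist_maximizers_le hSc hSne hα hδ
    obtain ⟨K, β, hβ, hK⟩ := hdev τ hτ
    refine ⟨K, β, hβ, fun N hN => (measure_mono ?_).trans (hK N hN)⟩
    rintro ω ⟨xhat, hx, hlt⟩
    by_contra hω
    simp only [Set.mem_ofPred_eq, not_exists, not_and, not_lt] at hω
    exact absurd (h _ hω _ hx) (not_le.mpr hlt)
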